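/- Let $\mathbb{T}=\mathbb{R}/\mathbb{Z}$ be the circle group, let $\mathfrak{c}=|\mathbb{R}|$ be the cardinality of the continuum, and let $\mathbb{T}^{\mathfrak{c}}$ be the product of $\mathfrak{c}$ copies of $\mathbb{T}$, with the coordinatewise group operation and the Tychonoff product topology. Call an abelian group $G$ bounded if there is a positive integer $n$ such that $nx=0$ for all $x\in G$. Then an abelian group $G$ is isomorphic (as an abstract group) to a dense subgroup of $\mathbb{T}^{\mathfrak{c}}$ if and only if $G$ is not bounded and $|G|\le 2^{\mathfrak{c}}$. -/

import Mathlib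

universe u v

open Cardinal

/-! A homomorphism `G →+ (I → UnitAddCircle)` is a family of characters: it is injective iff they
separate points, and by Kronecker's theorem its image is dense if they are independent over ℤ. So a
separating independent family of size 𝔠 is wanted. Unboundedness gives 𝔠 characters with pairwise
differences of infinite order, so fewer than 𝔠 characters never span all others up to torsion, and
transfinite recursion makes any `ψ j + p j • θ j` independent. Adding `p • θ` changes nothing on
elements killed by `p`, so separation of prime-order elements survives. Elements of infinite order
are detected by characters with torsion-free image, of which a maximal part independent modulo the
others suffices. Conversely, `n • x = 0` is a closed condition and the torus has 2 ^ 𝔠 points. -/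

/-! ### Kronecker density in tori. -/

theorem UnitAddTorus.mFourier_eq_toCircle {d : Type*} [Fintype d] (n : d → ℤ)
    (x : UnitAddTorus d) :
    UnitAddTorus.mFourier n x = (AddCircle.toCircle (∑ i, n i • x i) : ℂ) := by
  classical
  have key : ∀ s : Finset d, ∏ i ∈ s, fourier (n i) (x i) =
      (AddCircle.toCircle (∑ i ∈ s, n i • x i) : ℂ) := by
    intro s
    induction s using Finset.induction_on with
    | empty => simp
    | insert a s ha ih =>
      rw [Finset.prod_insert ha, Finset.sum_insert ha, ih, AddCircle.toCircle_add, fourier_apply]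
      simp
  exact key Finset.univ

theorem UnitAddTorus.mFourier_apply_add {d : Type*} [Fintype d] (n : d → ℤ)
    (x y : UnitAddTorus d) :
    UnitAddTorus.mFourier n (x + y) = UnitAddTorus.mFourier n x * UnitAddTorus.mFourier n y := by
  simp only [mFourier_eq_toCircle, Pi.add_apply, smul_add, Finset.sum_add_distrib,
    AddCircle.toCircle_add, Circle.coe_mul]

/-- Integration of the translate of a function over a closed subgroup of a torus. -/
noncomputable def UnitAddTorus.translateIntegral {d : Type*} [Fintype d]
    (K : AddSubgroup (UnitAddTorus d)) (μ : MeasureTheory.Measure K)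
    [MeasureTheory.IsFiniteMeasure μ] [CompactSpace K]
    (x : UnitAddTorus d) : C(UnitAddTorus d, ℂ) →L[ℂ] ℂ :=
  LinearMap.mkContinuous
    { toFun := fun f => ∫ k : K, f (x + k) ∂μ
      map_add' := fun f g => by
        have h (f : C(UnitAddTorus d, ℂ)) :
            MeasureTheory.Integrable (fun k : K => f (x + k)) μ :=
          Continuous.integrable_of_hasCompactSupport (by fun_prop)
            (HasCompactSupport.of_compactSpace _)
        simpa using MeasureTheory.integral_add (h f) (h g)
      map_smul' := fun c f => by
        simpa using MeasureTheory.integral_const_mul c (fun k : K => f (x + k)) }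
    (μ.real Set.univ)
    (fun f => by
      have := MeasureTheory.norm_integral_le_of_norm_le_const (μ := μ)
        (f := fun k : K => f (x + k)) (C := ‖f‖)
        (Filter.Eventually.of_forall fun k => f.norm_coe_le_norm _)
      simpa [mul_comm] using this)

/-- A character nontrivial on `K` has Haar integral zero over every coset of `K`. Trigonometric
polynomials being dense, all cosets integrate alike, yet a Urysohn function would tell `K` from
another coset. -/
theorem UnitAddTorus.eq_top_of_isClosed {d : Type*} [Fintype d]
    (K : AddSubgroup (UnitAddTorus d)) (hK : IsClosed (K : Set (UnitAddTorus d)))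
    (h : ∀ n : d → ℤ, n ≠ 0 → ∃ x ∈ K, ∑ i, n i • x i ≠ 0) : K = ⊤ := by
  have : CompactSpace K := isCompact_iff_compactSpace.mp hK.isCompact
  let μ : MeasureTheory.Measure K := MeasureTheory.Measure.addHaar
  have hconst : ∀ x, translateIntegral K μ x = translateIntegral K μ 0 := by
    intro x
    refine ContinuousLinearMap.ext_on (s := Set.range (mFourier (d := d)))
      (Submodule.dense_iff_topologicalClosure_eq_top.mpr span_mFourier_closure_eq_top) ?_
    rintro _ ⟨n, rfl⟩
    change ∫ k : K, mFourier n (x + k) ∂μ = ∫ k : K, mFourier n (0 + k) ∂μ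
    by_cases hn : n = 0
    · simp [hn, mFourier_zero]
    obtain ⟨y, hy, hny⟩ := h n hn
    have hzero : ∫ k : K, mFourier n k ∂μ = 0 := by
      have h1 := MeasureTheory.integral_add_left_eq_self (μ := μ)
        (fun k : K => mFourier n k) ⟨y, hy⟩
      simp only [AddSubgroup.coe_add, mFourier_apply_add] at h1
      rw [MeasureTheory.integral_const_mul] at h1
      have h2 : mFourier n y ≠ 1 := by
        rw [mFourier_eq_toCircle]
        intro h3
        apply hny
        apply AddCircle.injective_toCircle one_ne_zero
        ext
        simpa using h3
      have h4 : (mFourier n y - 1) * ∫ k : K, mFourier n k ∂μ = 0 := by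
        rw [sub_mul, h1]; ring
      exact (mul_eq_zero.mp h4).resolve_left (sub_ne_zero.mpr h2)
    simp only [mFourier_apply_add]
    rw [MeasureTheory.integral_const_mul, MeasureTheory.integral_const_mul, hzero]
    simp
  rw [eq_top_iff]
  intro x _
  by_contra hx
  let s : Set (UnitAddTorus d) := (fun y => x + y) '' K
  have hs : IsClosed s := (hK.isCompact.image (by fun_prop)).isClosed
  have hd : Disjoint (K : Set (UnitAddTorus d)) s := by
    rw [Set.disjoint_left]
    rintro _ hy ⟨k, hk, rfl⟩
    exact hx ((AddSubgroup.add_mem_cancel_right K hk).mp hy)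
  obtain ⟨f, hf0, hf1, -⟩ := exists_continuous_zero_one_of_isClosed hK hs hd
  let F : C(UnitAddTorus d, ℂ) := ⟨fun y => (f y : ℂ), by fun_prop⟩
  have h1 : translateIntegral K μ x F = ∫ k : K, (1 : ℂ) ∂μ := by
    change ∫ k : K, F (x + k) ∂μ = _
    refine MeasureTheory.integral_congr_ae (Filter.Eventually.of_forall fun k => ?_)
    have : f (x + k) = 1 := hf1 ⟨k, k.2, rfl⟩
    simp [F, this]
  have h0 : translateIntegral K μ 0 F = 0 := by
    change ∫ k : K, F (0 + k) ∂μ = _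
    have : ∀ k : K, F (0 + k) = 0 := fun k => by
      have : f k = 0 := hf0 k.2
      simp [F, this]
    simp only [this, MeasureTheory.integral_zero]
  rw [hconst, h0] at h1
  have h2 : μ.real Set.univ ≠ 0 := by
    have : μ Set.univ ≠ 0 := (isOpen_univ.measure_pos μ Set.univ_nonempty).ne'
    simp [MeasureTheory.measureReal_def, ENNReal.toReal_eq_zero_iff, this]
  apply h2
  simpa using h1.symm

/-- Linearly independent characters have dense joint image in the torus. -/
theorem LinearIndependent.denseRange_unitAddCircle {G I : Type*} [AddCommGroup G]
    {v : I → (G →+ UnitAddCircle)} (hv : LinearIndependent ℤ v) :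
    DenseRange (fun (g : G) (i : I) => v i g) := by
  rw [DenseRange, dense_iff_inter_open]
  rintro U hU ⟨x, hx⟩
  obtain ⟨F, u, hu, hFU⟩ := isOpen_pi_iff.mp hU x hx
  let φ : G →+ UnitAddTorus F := AddMonoidHom.mk' (fun g i => v i g) (fun a b => by ext; simp)
  have htop : φ.range.topologicalClosure = ⊤ := by
    refine UnitAddTorus.eq_top_of_isClosed _ (AddSubgroup.isClosed_topologicalClosure _) ?_
    intro n hn
    by_contra! hcon
    have h0 : ∑ i, n i • v i = 0 := by
      ext g
      have := hcon (φ g) (AddSubgroup.le_topologicalClosure _ ⟨g, rfl⟩)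
      simpa [φ] using this
    apply hn
    funext i
    exact (Fintype.linearIndependent_iff.mp (hv.comp ((↑) : F → I) Subtype.val_injective)) n h0 i
  have hdense : Dense (φ.range : Set (UnitAddTorus F)) := by
    rw [dense_iff_closure_eq, ← AddSubgroup.topologicalClosure_coe, htop]; rfl
  have hopen : IsOpen (Set.univ.pi fun i : F => u i) :=
    isOpen_set_pi Set.finite_univ fun i _ => (hu i i.2).1
  obtain ⟨_, hy, g, rfl⟩ := hdense.inter_open_nonempty _ hopen
    ⟨fun i => x i, fun i _ => (hu i i.2).2⟩
  exact ⟨_, hFU fun i hi => hy ⟨i, hi⟩ (Set.mem_univ _), g, rfl⟩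

/-! ### Large families of characters of an unbounded group. -/

/-- The circle group is injective. -/
theorem AddMonoidHom.exists_extension_unitAddCircle {H G : Type*} [AddCommGroup H]
    [AddCommGroup G] (i : H →+ G) (hi : Function.Injective i) (f : H →+ UnitAddCircle) :
    ∃ g : G →+ UnitAddCircle, ∀ x, g (i x) = f x := by
  obtain ⟨g, hg⟩ := (Module.Baer.of_divisible UnitAddCircle).extension_property_addMonoidHom i hi f
  exact ⟨g, fun x => DFunLike.congr_fun hg x⟩

/-- Modulo a bounded subgroup, an unbounded group has elements of arbitrarily large order. -/
theorem AddSubgroup.exists_forall_nsmul_notMem {G : Type*} [AddCommGroup G]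
    (hG : ¬ ∃ n : ℕ, 0 < n ∧ ∀ x : G, n • x = 0) (H : AddSubgroup G)
    (hH : ∃ M : ℕ, 0 < M ∧ ∀ h ∈ H, M • h = 0) (N : ℕ) :
    ∃ g : G, ∀ j : ℕ, 0 < j → j ≤ N → j • g ∉ H := by
  by_contra! hcon
  obtain ⟨M, hM, hMH⟩ := hH
  refine hG ⟨M * N.factorial, Nat.mul_pos hM N.factorial_pos, fun x => ?_⟩
  obtain ⟨j, hj, hjN, hjx⟩ := hcon x
  obtain ⟨c, hc⟩ := Nat.dvd_factorial hj hjN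
  rw [mul_nsmul', hc, mul_nsmul']
  exact hMH _ (by rw [smul_comm]; exact H.nsmul_mem hjx c)

/-- A character vanishing on `H` and faithful on the image of `g` modulo `H`. -/
theorem AddSubgroup.exists_character_faithful {G : Type*} [AddCommGroup G] (H : AddSubgroup G)
    (g : G) (hg : ∃ n : ℕ, 0 < n ∧ n • g = 0) :
    ∃ θ : G →+ UnitAddCircle, (∀ h ∈ H, θ h = 0) ∧ ∀ j : ℕ, j • θ g = 0 → j • g ∈ H := by
  let q : G ⧸ H := QuotientAddGroup.mk' H g
  have hq : 0 < addOrderOf q := by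
    obtain ⟨n, hn, hng⟩ := hg
    refine addOrderOf_pos_iff.mpr (isOfFinAddOrder_iff_nsmul_eq_zero.mpr ⟨n, hn, ?_⟩)
    rw [← map_nsmul, hng, map_zero]
  have : NeZero (addOrderOf q) := ⟨hq.ne'⟩
  let i : ZMod (addOrderOf q) →+ G ⧸ H :=
    ZMod.lift _ ⟨zmultiplesHom _ q, by simp [addOrderOf_nsmul_eq_zero]⟩
  have hi : Function.Injective i := by
    rw [ZMod.lift_injective]
    intro m hm
    rw [ZMod.intCast_zmod_eq_zero_iff_dvd]
    exact addOrderOf_dvd_iff_zsmul_eq_zero.mpr (by simpa using hm)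
  obtain ⟨f, hf⟩ := AddMonoidHom.exists_extension_unitAddCircle i hi ZMod.toAddCircle
  have hi1 (j : ℕ) : i (j : ZMod (addOrderOf q)) = j • q := by
    have := ZMod.lift_coe (addOrderOf q)
      ⟨zmultiplesHom _ q, by simp [addOrderOf_nsmul_eq_zero]⟩ (j : ℤ)
    simpa [i] using this
  refine ⟨f.comp (QuotientAddGroup.mk' H), fun h hh => ?_, fun j hj => ?_⟩
  · have : QuotientAddGroup.mk' H h = 0 := (QuotientAddGroup.eq_zero_iff h).mpr hh
    simp only [AddMonoidHom.comp_apply, this, map_zero]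
  · have h1 : f (i (j : ZMod (addOrderOf q))) = 0 := by
      rw [hi1, map_nsmul]; exact hj
    rw [hf, ZMod.toAddCircle_eq_zero] at h1
    have h2 := hi1 j
    rw [h1, map_zero] at h2
    refine (QuotientAddGroup.eq_zero_iff _).mp ?_
    exact h2.symm

/-- Pigeonhole on the multiples `c • θ` with `c ≤ S.card`: each `σ` excludes at most one `c`, as `g`
has order above `k * S.card` modulo `H`. -/
theorem AddSubgroup.exists_character_avoiding {G : Type*} [AddCommGroup G]
    (hG : ¬ ∃ n : ℕ, 0 < n ∧ ∀ x : G, n • x = 0) (hT : ∀ g : G, ∃ n : ℕ, 0 < n ∧ n • g = 0)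
    (H : AddSubgroup G) (hH : ∃ M : ℕ, 0 < M ∧ ∀ h ∈ H, M • h = 0)
    (S : Finset (G →+ UnitAddCircle)) (k : ℕ) (hk : 0 < k) :
    ∃ (g : G) (θ : G →+ UnitAddCircle), (∀ h ∈ H, θ h = 0) ∧
      ∀ σ ∈ S, k • (θ g + σ g) ≠ 0 := by
  obtain ⟨g, hg⟩ := H.exists_forall_nsmul_notMem hG hH (k * S.card)
  obtain ⟨θ, hθH, hθ⟩ := H.exists_character_faithful g (hT g)
  by_contra! hcon
  have h1 : ∀ c : ℕ, ∃ σ ∈ S, k • (c • θ g + σ g) = 0 := fun c => by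
    simpa using hcon g (c • θ) (fun h hh => by simp [hθH h hh])
  choose σ hσS hσ using h1
  obtain ⟨a, ha, b, hb, hab, hσab⟩ := Finset.exists_ne_map_eq_of_card_lt_of_maps_to
    (s := Finset.range (S.card + 1)) (t := S) (by simp) (f := σ) (fun c _ => hσS c)
  wlog hlt : a < b generalizing a b
  · exact this b hb a ha hab.symm hσab.symm (lt_of_le_of_ne (not_lt.mp hlt) hab.symm)
  obtain ⟨d, rfl⟩ := Nat.exists_eq_add_of_lt hlt
  have h2 := hσ a
  have h3 := hσ (a + d + 1)
  rw [← hσab] at h3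
  refine hg (k * (d + 1)) (by positivity) ?_ (hθ _ ?_)
  · rw [Finset.mem_range] at hb
    exact Nat.mul_le_mul_left k (by omega)
  · have h4 : (k * (d + 1)) • θ g =
        k • ((a + d + 1) • θ g + σ a g) - k • (a • θ g + σ a g) := by
      rw [mul_nsmul', add_assoc a d 1, add_nsmul (θ g) a (d + 1), ← nsmul_sub]
      congr 1; abel
    rw [h4, h2, h3, sub_zero]

/-- The recursion carries the subgroup generated by earlier `g`, bounded because `G` is torsion, and
a finite set containing every signed sum of earlier `θ`. -/
theorem exists_independent_character_seq {G : Type*} [AddCommGroup G]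
    (hG : ¬ ∃ n : ℕ, 0 < n ∧ ∀ x : G, n • x = 0) (hT : ∀ g : G, ∃ n : ℕ, 0 < n ∧ n • g = 0) :
    ∃ (g : ℕ → G) (θ : ℕ → (G →+ UnitAddCircle)), (∀ m n, m < n → θ n (g m) = 0) ∧
      ∀ (ε : ℕ → ℤ), (∀ i, ε i = 0 ∨ ε i = 1 ∨ ε i = -1) → ∀ n, ε n = 1 →
        n.factorial • (∑ i ∈ Finset.range (n + 1), ε i • θ i) (g n) ≠ 0 := by
  classical
  let State := {p : AddSubgroup G × Finset (G →+ UnitAddCircle) //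
    ∃ M : ℕ, 0 < M ∧ ∀ h ∈ p.1, M • h = 0}
  have hstep : ∀ (s : State) (n : ℕ), ∃ (g : G) (θ : G →+ UnitAddCircle),
      (∀ h ∈ s.1.1, θ h = 0) ∧ ∀ σ ∈ s.1.2, n.factorial • (θ g + σ g) ≠ 0 := fun s n =>
    s.1.1.exists_character_avoiding hG hT s.2 s.1.2 _ n.factorial_pos
  choose g θ hθH hθ using hstep
  let next : ℕ → State → State := fun n s =>
    ⟨(s.1.1 ⊔ AddSubgroup.zmultiples (g s n),
      s.1.2 ∪ (s.1.2.image (· + θ s n)) ∪ (s.1.2.image (· - θ s n))), by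
      obtain ⟨M, hM, hMs⟩ := s.2
      obtain ⟨N, hN, hNg⟩ := hT (g s n)
      refine ⟨M * N, Nat.mul_pos hM hN, fun h hh => ?_⟩
      obtain ⟨y, hy, z, hz, rfl⟩ := AddSubgroup.mem_sup.mp hh
      obtain ⟨c, rfl⟩ := AddSubgroup.mem_zmultiples_iff.mp hz
      rw [nsmul_add, mul_nsmul, hMs y hy, nsmul_zero, zero_add, mul_nsmul', smul_comm N c, hNg,
        smul_zero, smul_zero]⟩
  let st : ℕ → State := fun n =>
    Nat.rec ⟨(⊥, {0}), 1, one_pos, fun h hh => by simpa using hh⟩ next n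
  have hst : ∀ n, st (n + 1) = next n (st n) := fun n => rfl
  refine ⟨fun n => g (st n) n, fun n => θ (st n) n, fun m n hmn => hθH _ _ _ ?_, ?_⟩
  · induction n with
    | zero => omega
    | succ n ih =>
      rw [hst]
      change _ ∈ (st n).1.1 ⊔ AddSubgroup.zmultiples (g (st n) n)
      rcases Nat.lt_succ_iff_lt_or_eq.mp hmn with h | rfl
      · exact AddSubgroup.mem_sup_left (ih h)
      · exact AddSubgroup.mem_sup_right (AddSubgroup.mem_zmultiples _)
  · intro ε hε n hn
    have hmem : ∀ n, ∑ i ∈ Finset.range n, ε i • θ (st i) i ∈ (st n).1.2 := by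
      intro n
      induction n with
      | zero => exact Finset.mem_singleton_self _
      | succ n ih =>
        rw [hst, Finset.sum_range_succ]
        change _ ∈ (st n).1.2 ∪ ((st n).1.2.image (· + θ (st n) n)) ∪
          ((st n).1.2.image (· - θ (st n) n))
        rw [Finset.mem_union, Finset.mem_union, Finset.mem_image, Finset.mem_image]
        rcases hε n with h | h | h
        · left; left; simpa [h] using ih
        · left; right; exact ⟨_, ih, by simp [h]⟩
        · right; exact ⟨_, ih, by simp [h, sub_eq_add_neg]⟩
    have := hθ (st n) n _ (hmem n)
    rwa [Finset.sum_range_succ, hn, one_smul, add_comm, AddMonoidHom.add_apply]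

/-- Continuum many characters of an unbounded torsion group whose pairwise differences have
infinite order. -/
theorem exists_character_family_of_torsion {G : Type*} [AddCommGroup G]
    (hG : ¬ ∃ n : ℕ, 0 < n ∧ ∀ x : G, n • x = 0) (hT : ∀ g : G, ∃ n : ℕ, 0 < n ∧ n • g = 0) :
    ∃ f : (ℕ → Bool) → (G →+ UnitAddCircle),
      ∀ x y, x ≠ y → ∀ k : ℤ, k ≠ 0 → k • f x ≠ k • f y := by
  obtain ⟨g, θ, hθ, hind⟩ := exists_independent_character_seq hG hT
  -- Each bit of `x` is repeated at infinitely many indices, so a differing bit recurs at some `n`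
  -- with `k ∣ n!`.
  let b : (ℕ → Bool) → ℕ → ℤ := fun x i => if x i.unpair.1 then 1 else 0
  let s : (ℕ → Bool) → ℕ → (G →+ UnitAddCircle) :=
    fun x N => ∑ i ∈ Finset.range N, b x i • θ i
  -- The series need not converge off the `g n`; compactness of the circle supplies an ultrafilter
  -- limit, still additive.
  let U := Filter.hyperfilter ℕ
  have hlim : ∀ x a, ∃ c, Filter.Tendsto (fun N => s x N a) U (nhds c) := fun x a =>
    ⟨_, (U.map fun N => s x N a).le_nhds_lim⟩
  choose χ hχ using hlim
  let f : (ℕ → Bool) → (G →+ UnitAddCircle) := fun x => AddMonoidHom.mk' (χ x) fun a c =>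
    tendsto_nhds_unique (hχ x (a + c)) (by simpa using (hχ x a).add (hχ x c))
  have hval : ∀ x n, f x (g n) = s x (n + 1) (g n) := by
    intro x n
    refine tendsto_nhds_unique (hχ x (g n)) (tendsto_const_nhds.congr' ?_)
    refine Nat.hyperfilter_le_atTop ?_
    filter_upwards [Filter.eventually_ge_atTop (n + 1)] with N hN
    simp only [s, AddMonoidHom.finsetSum_apply]
    refine Finset.sum_subset (Finset.range_mono hN) fun i _ hi => ?_
    rw [Finset.mem_range, not_lt] at hi
    simp [hθ n i hi]
  refine ⟨f, ?_⟩
  have key : ∀ x y a, x a = true → y a = false → ∀ k : ℤ, k ≠ 0 → k • f x ≠ k • f y := by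
    intro x y a hxa hya k hk heq
    let n := Nat.pair a k.natAbs
    have hn : n.unpair.1 = a := by simp [n]
    have hdvd : k.natAbs ∣ n.factorial :=
      Nat.dvd_factorial (Int.natAbs_pos.mpr hk) (Nat.right_le_pair _ _)
    obtain ⟨c, hc⟩ := Int.natAbs_dvd.mp (Int.natCast_dvd_natCast.mpr hdvd)
    refine hind (fun i => b x i - b y i) (fun i => ?_) n (by simp [b, hn, hxa, hya]) ?_
    · dsimp only [b]
      split_ifs <;> simp
    · have h1 : (∑ i ∈ Finset.range (n + 1), (b x i - b y i) • θ i) (g n) =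
          f x (g n) - f y (g n) := by
        rw [hval, hval]
        simp only [s, sub_smul, Finset.sum_sub_distrib, AddMonoidHom.sub_apply]
      have h2 := DFunLike.congr_fun heq (g n)
      rw [AddMonoidHom.smul_apply, AddMonoidHom.smul_apply] at h2
      rw [h1, ← natCast_zsmul, hc, mul_comm, mul_smul, smul_sub, h2, sub_self, smul_zero]
  intro x y hxy k hk
  obtain ⟨a, ha⟩ := Function.ne_iff.mp hxy
  cases hxa : x a <;> cases hya : y a
  · simp [hxa, hya] at ha
  · exact (key y x a hya hxa k hk).symm
  · exact key x y a hxa hya k hk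
  · simp [hxa, hya] at ha

theorem exists_character_family {G : Type*} [AddCommGroup G]
    (hG : ¬ ∃ n : ℕ, 0 < n ∧ ∀ x : G, n • x = 0) :
    ∃ (X : Type) (f : X → (G →+ UnitAddCircle)), #X = 𝔠 ∧
      ∀ x y, x ≠ y → ∀ k : ℤ, k ≠ 0 → k • f x ≠ k • f y := by
  by_cases hT : ∀ g : G, ∃ n : ℕ, 0 < n ∧ n • g = 0
  · obtain ⟨f, hf⟩ := exists_character_family_of_torsion hG hT
    exact ⟨_, f, by simp, hf⟩
  push Not at hT
  obtain ⟨g, hg⟩ := hT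
  -- An element of infinite order may be sent anywhere; values from distinct classes of ℝ/ℚ differ
  -- by elements of infinite order.
  let Q : AddSubgroup ℝ := (Rat.castHom ℝ).toAddMonoidHom.range
  have hinj : Function.Injective (zmultiplesHom G g) := by
    rw [injective_iff_map_eq_zero]
    intro n hn
    by_contra hn0
    exact hg n.natAbs (Int.natAbs_pos.mpr hn0) (by simpa using hn)
  choose f hf using fun a : ℝ => AddMonoidHom.exists_extension_unitAddCircle _ hinj
    (zmultiplesHom UnitAddCircle (a : UnitAddCircle))
  have hfg : ∀ a, f a g = a := fun a => by simpa using hf a 1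
  refine ⟨ℝ ⧸ Q, fun x => f x.out, ?_, ?_⟩
  · have h1 : 𝔠 = #(ℝ ⧸ Q) * #Q := by
      rw [mul_def, ← mk_real]
      exact mk_congr AddSubgroup.addGroupEquivQuotientProdAddSubgroup
    have h2 : #Q < 𝔠 :=
      (le_aleph0_iff_set_countable.mpr (Set.countable_range (Rat.castHom ℝ))).trans_lt
        aleph0_lt_continuum
    refine le_antisymm (mk_real ▸ mk_le_of_surjective (QuotientAddGroup.mk'_surjective Q)) ?_
    by_contra! h3
    exact (mul_lt_of_lt aleph0_le_continuum h3 h2).ne h1.symm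
  · intro x y hxy k hk heq
    apply hxy
    have h1 := DFunLike.congr_fun heq g
    simp only [AddMonoidHom.smul_apply, hfg] at h1
    rw [← AddCircle.coe_zsmul, ← AddCircle.coe_zsmul, ← sub_eq_zero, ← AddCircle.coe_sub,
      AddCircle.coe_eq_zero_iff] at h1
    obtain ⟨m, hm⟩ := h1
    rw [← x.out_eq', ← y.out_eq']
    refine QuotientAddGroup.eq.mpr ⟨-(m / k : ℚ), ?_⟩
    have hk' : (k : ℝ) ≠ 0 := by exact_mod_cast hk
    simp only [zsmul_eq_mul, mul_one] at hm
    simp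
    field_simp
    linarith

/-! ### Independence by transfinite recursion. -/

theorem Submodule.mk_span_int_lt_continuum {A : Type*} [AddCommGroup A] (S : Set A)
    (hS : #S < 𝔠) : #(Submodule.span ℤ S) < 𝔠 := by
  have h1 : #(S →₀ ℤ) < 𝔠 := by
    rcases S.eq_empty_or_nonempty with rfl | hne
    · exact (lt_aleph0_of_finite _).trans aleph0_lt_continuum
    · have := hne.to_subtype
      rw [mk_finsupp_lift_of_infinite']
      simpa using ⟨hS, aleph0_lt_continuum⟩
  refine lt_of_le_of_lt ?_ h1
  rw [← Subtype.range_coe (s := S), ← Finsupp.range_linearCombination, Subtype.range_coe]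
  exact mk_range_le

/-- Fewer than continuum many characters of an unbounded group do not span its character group,
even modulo torsion. -/
theorem exists_character_zsmul_notMem_span {G : Type u} [AddCommGroup G]
    (hG : ¬ ∃ n : ℕ, 0 < n ∧ ∀ x : G, n • x = 0) (S : Set (G →+ UnitAddCircle)) (hS : #S < 𝔠) :
    ∃ θ : G →+ UnitAddCircle, ∀ k : ℤ, k ≠ 0 → k • θ ∉ Submodule.span ℤ S := by
  obtain ⟨X, f, hX, hf⟩ := exists_character_family hG
  by_contra! hcon
  choose k hk hmem using hcon
  let φ : X → ℤ × Submodule.span ℤ S := fun x => (k (f x), ⟨_, hmem (f x)⟩)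
  have hφ : Function.Injective φ := by
    intro x y hxy
    by_contra hne
    simp only [φ, Prod.mk.injEq, Subtype.mk.injEq] at hxy
    refine hf x y hne _ (hk (f x)) ?_
    rw [hxy.2, hxy.1]
  have h1 := mk_le_of_injective (f := fun x : ULift.{u} X => φ x.down)
    (hφ.comp ULift.down_injective)
  rw [mk_uLift, hX, lift_continuum, mk_prod] at h1
  refine h1.not_gt (mul_lt_of_lt aleph0_le_continuum ?_ ?_)
  · simpa using aleph0_lt_continuum
  · simpa using Submodule.mk_span_int_lt_continuum S hS

/-- In a nontrivial relation, solve for the term of largest index. -/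
theorem LinearIndependent.of_notMem_span_Iio {J A : Type*} [LinearOrder J] [AddCommGroup A]
    (χ : J → A) (h : ∀ j, ∀ k : ℤ, k ≠ 0 → k • χ j ∉ Submodule.span ℤ (χ '' Set.Iio j)) :
    LinearIndependent ℤ χ := by
  classical
  rw [linearIndependent_iff']
  intro s c hsum
  by_contra! hcon
  obtain ⟨i, hi, hci⟩ := hcon
  let t := s.filter fun j => c j ≠ 0
  have ht : t.Nonempty := ⟨i, by simp [t, hi, hci]⟩
  let m := t.max' ht
  have hm := t.max'_mem ht
  have hm' : m ∈ s ∧ c m ≠ 0 := by simpa [t] using hm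
  refine h m (c m) hm'.2 ?_
  have h1 : c m • χ m = - ∑ j ∈ s.erase m, c j • χ j := by
    rw [eq_neg_iff_add_eq_zero, Finset.add_sum_erase _ (fun j => c j • χ j) hm'.1, hsum]
  rw [h1]
  refine Submodule.neg_mem _ (Submodule.sum_mem _ fun j hj => ?_)
  rw [Finset.mem_erase] at hj
  by_cases hcj : c j = 0
  · simp [hcj]
  · refine Submodule.smul_mem _ _ (Submodule.subset_span ⟨j, ?_, rfl⟩)
    exact lt_of_le_of_ne (t.le_max' j (by simp [t, hj.2, hcj])) hj.1

/-- Characters may be made linearly independent by adding prescribed multiples of characters. -/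
theorem exists_linearIndependent_add_smul {G : Type u} [AddCommGroup G]
    (hG : ¬ ∃ n : ℕ, 0 < n ∧ ∀ x : G, n • x = 0) {J : Type v} (hJ : #J = 𝔠)
    (ψ : J → (G →+ UnitAddCircle)) (p : J → ℤ) (hp : ∀ j, p j ≠ 0) :
    ∃ θ : J → (G →+ UnitAddCircle), LinearIndependent ℤ fun j => ψ j + p j • θ j := by
  obtain ⟨_, _, hord⟩ := exists_ord_eq_type_lt J
  have hR : ∀ (j : J) (S : Set (G →+ UnitAddCircle)), ∃ θ : G →+ UnitAddCircle,
      #S < 𝔠 → ∀ k : ℤ, k ≠ 0 → k • (ψ j + p j • θ) ∉ Submodule.span ℤ S := by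
    intro j S
    by_cases hS : #S < 𝔠
    -- With `ψ j` adjoined to `S`, the summand `k • ψ j` can be subtracted, leaving `(k * p j) • θ`.
    · obtain ⟨θ, hθ⟩ := exists_character_zsmul_notMem_span hG (insert (ψ j) S) <|
        (mk_insert_le).trans_lt (add_lt_of_lt aleph0_le_continuum hS
          (one_lt_aleph0.trans aleph0_lt_continuum))
      refine ⟨θ, fun _ k hk hmem => hθ (k * p j) (mul_ne_zero hk (hp j)) ?_⟩
      have h1 := Submodule.span_mono (R := ℤ) (Set.subset_insert (ψ j) S) hmem
      have h2 : ψ j ∈ Submodule.span ℤ (insert (ψ j) S) :=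
        Submodule.subset_span (Set.mem_insert _ _)
      have h3 := Submodule.sub_mem _ h1 (Submodule.smul_mem _ k h2)
      rwa [smul_add, add_sub_cancel_left, ← mul_smul] at h3
    · exact ⟨0, fun h => absurd h hS⟩
  choose Θ hΘ using hR
  let θ : J → (G →+ UnitAddCircle) := WellFoundedLT.fix fun j ih =>
    Θ j (Set.range fun i : Set.Iio j => ψ i + p i • ih i i.2)
  have hθ : ∀ j, θ j = Θ j ((fun i => ψ i + p i • θ i) '' Set.Iio j) := by
    intro j
    rw [Set.image_eq_range]
    exact WellFoundedLT.fix_eq _ j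
  refine ⟨θ, LinearIndependent.of_notMem_span_Iio _ fun j => ?_⟩
  have := hΘ j ((fun i => ψ i + p i • θ i) '' Set.Iio j) ?_
  · rwa [← hθ] at this
  · have h1 := mk_image_le_lift (f := fun i => ψ i + p i • θ i) (s := Set.Iio j)
    have h2 := mk_Iio_lt j hord
    rw [hJ] at h2
    rw [← lift_lt_continuum.{_, v}]
    exact h1.trans_lt (lift_lt_continuum.mpr h2)

/-! ### Separating families. -/

/-- A vector space of cardinality at most `2 ^ 𝔠` embeds in a power of the field with continuum
many factors. -/
theorem exists_linearMap_injective_pi {K : Type} [Field K] {V : Type u} [AddCommGroup V]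
    [Module K V] (hV : #V ≤ 2 ^ 𝔠) {I : Type v} (hI : #I = 𝔠) :
    ∃ f : V →ₗ[K] (I → K), Function.Injective f := by
  have : Infinite I := infinite_iff.mpr (hI ▸ aleph0_le_continuum)
  refine lift_rank_le_iff_exists_linearMap.mp ?_
  rw [rank_fun_infinite]
  have h1 : (2 : Cardinal.{v}) ^ (𝔠 : Cardinal.{v}) ≤ #(I → K) := by
    rw [← hI]
    simp only [mk_pi, prod_const, lift_uzero]
    refine power_le_power_right ?_
    have h : lift.{v} (2 : Cardinal.{0}) ≤ lift.{v} #K := 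
      lift_le.mpr <| two_le_iff.mpr ⟨0, 1, zero_ne_one⟩
    simpa using h
  calc lift.{v} (Module.rank K V) ≤ lift.{v} #V := lift_le.mpr (rank_le_card K V)
    _ ≤ lift.{v} (2 ^ 𝔠) := lift_le.mpr hV
    _ = lift.{u} ((2 : Cardinal.{v}) ^ (𝔠 : Cardinal.{v})) := by simp
    _ ≤ _ := lift_le.mpr h1

/-- Continuum many characters separate the elements of prime order. -/
theorem exists_characters_separating_torsion {G : Type u} [AddCommGroup G] (hG : #G ≤ 2 ^ 𝔠)
    {I : Type v} (hI : #I = 𝔠) (p : ℕ) [Fact p.Prime] :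
    ∃ ψ : I → (G →+ UnitAddCircle), ∀ g : G, p • g = 0 → (∀ i, ψ i g = 0) → g = 0 := by
  let H : AddSubgroup G := (nsmulAddMonoidHom p : G →+ G).ker
  have hH : ∀ x : H, p • x = 0 := fun x => Subtype.ext x.2
  let _ : Module (ZMod p) H := AddCommGroup.zmodModule hH
  obtain ⟨f, hf⟩ := exists_linearMap_injective_pi (K := ZMod p)
    ((mk_subtype_le _).trans hG : #H ≤ 2 ^ 𝔠) hI
  let F : H →+ (I → ZMod p) := f.toAddMonoidHom
  choose ψ hψ using fun i => AddMonoidHom.exists_extension_unitAddCircle H.subtype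
    H.subtype_injective
    (ZMod.toAddCircle.comp ((Pi.evalAddMonoidHom (fun _ : I => ZMod p) i).comp F))
  refine ⟨ψ, fun g hg h0 => ?_⟩
  have h1 : F ⟨g, hg⟩ = 0 := by
    funext i
    have := hψ i ⟨g, hg⟩
    rw [AddSubgroup.subtype_apply, h0] at this
    exact (ZMod.toAddCircle_eq_zero).mp this.symm
  exact congrArg Subtype.val ((map_eq_zero_iff F hf).mp h1)

/-- Continuum many characters with torsion-free images separate the elements of infinite order. -/
theorem exists_characters_separating_modulo_torsion {G : Type u} [AddCommGroup G]
    (hG : #G ≤ 2 ^ 𝔠) {I : Type v} (hI : #I = 𝔠) :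
    ∃ ψ : I → (G →+ UnitAddCircle), (∀ i g, ∀ k : ℤ, k ≠ 0 → k • ψ i g = 0 → ψ i g = 0) ∧
      ∀ g : G, (∀ i, ψ i g = 0) → ∃ n : ℕ, 0 < n ∧ n • g = 0 := by
  let j : G →ₗ[ℤ] TensorProduct ℤ ℚ G := TensorProduct.mk ℤ ℚ G 1
  have hloc : IsLocalizedModule (nonZeroDivisors ℤ) j :=
    (isLocalizedModule_iff_isBaseChange _ ℚ _).mpr (TensorProduct.isBaseChange ℤ G ℚ)
  have hcard : #(TensorProduct ℤ ℚ G) ≤ 2 ^ 𝔠 := by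
    have hs := IsLocalizedModule.surj (nonZeroDivisors ℤ) j
    choose s hs using hs
    have hinj : Function.Injective s := by
      intro x y hxy
      have h1 := hs x
      rw [hxy, ← hs y] at h1
      exact IsLocalizedModule.smul_injective j _ h1
    refine (mk_le_of_injective hinj).trans ?_
    rw [mk_prod]
    have h2 : ℵ₀ ≤ (2 : Cardinal.{u}) ^ (𝔠 : Cardinal.{u}) :=
      aleph0_le_continuum.trans (cantor _).le
    refine mul_le_of_le h2 (by simpa using hG) (le_trans ?_ h2)
    rw [← lift_aleph0.{u, 0}, lift_le]
    exact mk_le_aleph0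
  obtain ⟨f, hf⟩ := exists_linearMap_injective_pi (K := ℚ) hcard hI
  -- The factor √2 makes ℚ embed in the circle: a nonzero `q * √2` is never an integer.
  let e : ℚ →+ UnitAddCircle := AddMonoidHom.mk' (fun q => ((q * √2 : ℝ) : UnitAddCircle))
    (fun a b => by push_cast; rw [add_mul, AddCircle.coe_add])
  have he : ∀ q, e q = 0 → q = 0 := by
    intro q hq
    obtain ⟨m, hm⟩ := (AddCircle.coe_eq_zero_iff _).mp hq
    by_contra hq0
    have : Irrational (q * √2) := irrational_sqrt_two.ratCast_mul hq0
    exact this ⟨m, by simpa using hm⟩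
  refine ⟨fun i => e.comp ((Pi.evalAddMonoidHom (fun _ : I => ℚ) i).comp
    (f.toAddMonoidHom.comp j.toAddMonoidHom)), fun i g k hk h => ?_, fun g hg => ?_⟩
  · change k • e (f (j g) i) = 0 at h
    change e (f (j g) i) = 0
    rw [← map_zsmul] at h
    rw [(smul_eq_zero.mp (he _ h)).resolve_left hk, map_zero]
  · have h1 : j g = 0 := (map_eq_zero_iff f hf).mp (funext fun i => he _ (hg i))
    obtain ⟨c, hc⟩ := (IsLocalizedModule.eq_zero_iff (nonZeroDivisors ℤ) j).mp h1
    refine ⟨(c : ℤ).natAbs, Int.natAbs_pos.mpr (nonZeroDivisors.coe_ne_zero c), ?_⟩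
    simpa [Submonoid.smul_def] using hc

/-- An unbounded group of size at most `2 ^ 𝔠` has a separating linearly independent family of
continuum many characters. -/
theorem exists_separating_linearIndependent {G : Type u} [AddCommGroup G]
    (hG : ¬ ∃ n : ℕ, 0 < n ∧ ∀ x : G, n • x = 0) (hcard : #G ≤ 2 ^ 𝔠)
    {I : Type v} (hI : #I = 𝔠) :
    ∃ χ : I → (G →+ UnitAddCircle), LinearIndependent ℤ χ ∧ ∀ g, (∀ i, χ i g = 0) → g = 0 := by
  choose ψ hψ using fun p : Nat.Primes =>
    haveI := Fact.mk p.2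
    exists_characters_separating_torsion hcard hI p
  obtain ⟨φ, hφtor, hφ⟩ := exists_characters_separating_modulo_torsion hcard hI
  have hJ : #(Nat.Primes × I) = 𝔠 := by
    rw [mk_prod, mk_eq_aleph0, hI, lift_aleph0, lift_continuum, aleph0_mul_continuum]
  obtain ⟨θ, hθ⟩ := exists_linearIndependent_add_smul hG hJ (fun j => ψ j.1 j.2)
    (fun j => (j.1 : ℕ)) (fun j => by exact_mod_cast j.1.2.ne_zero)
  set ξ : Nat.Primes × I → (G →+ UnitAddCircle) := fun j => ψ j.1 j.2 + ((j.1 : ℕ) : ℤ) • θ j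
  let P := Submodule.span ℤ (Set.range ξ)
  -- A discarded `φ i` has a nonzero multiple in the span of the kept characters, so it vanishes
  -- wherever they do, its image being torsion-free.
  obtain ⟨s, hs, hmax⟩ := exists_maximal_linearIndepOn ℤ (fun i => P.mkQ (φ i))
  have hind : LinearIndependent ℤ (Sum.elim ξ (fun i : s => φ i)) := by
    refine LinearIndependent.sumElim_of_quotient (M' := P)
      (f := fun j => ⟨ξ j, Submodule.subset_span ⟨j, rfl⟩⟩) ?_ (fun i : s => φ i) hs
    exact LinearIndependent.of_comp P.subtype hθ
  have hK : #((Nat.Primes × I) ⊕ s) = #I := by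
    rw [mk_sum, hJ, hI, lift_continuum]
    exact add_eq_left aleph0_le_continuum (by simpa using hI ▸ mk_set_le s)
  obtain ⟨eqv⟩ := Cardinal.eq.mp hK
  refine ⟨Sum.elim ξ (fun i : s => φ i) ∘ eqv.symm, hind.comp _ eqv.symm.injective,
    fun g hg => ?_⟩
  have hξ : ∀ j, ξ j g = 0 := fun j => by simpa using hg (eqv (Sum.inl j))
  have hs0 : ∀ i ∈ s, φ i g = 0 := fun i hi => by simpa using hg (eqv (Sum.inr ⟨i, hi⟩))
  let ev : (G →+ UnitAddCircle) →ₗ[ℤ] UnitAddCircle := (AddMonoidHom.eval g).toIntLinearMap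
  have hP : P ≤ LinearMap.ker ev := Submodule.span_le.mpr (by rintro _ ⟨j, rfl⟩; exact hξ j)
  have hφ0 : ∀ i, φ i g = 0 := by
    intro i
    by_cases hi : i ∈ s
    · exact hs0 i hi
    obtain ⟨a, ha, hmem⟩ := hmax i hi
    refine hφtor i g a ha ?_
    have h1 : a • P.mkQ (φ i) ∈ (LinearMap.ker ev).map P.mkQ := by
      refine Submodule.span_le.mpr ?_ hmem
      rintro _ ⟨i', hi', rfl⟩
      exact ⟨φ i', hs0 i' hi', rfl⟩
    obtain ⟨y, hy, hya⟩ := h1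
    rw [← map_smul, ← sub_eq_zero, ← map_sub] at hya
    have h2 : y - a • φ i ∈ LinearMap.ker ev :=
      hP ((Submodule.Quotient.mk_eq_zero P).mp hya)
    have h3 := Submodule.sub_mem _ hy h2
    rw [sub_sub_cancel] at h3
    exact h3
  by_contra hg0
  obtain ⟨n, hn, hng⟩ := hφ g hφ0
  have hord : addOrderOf g ≠ 1 := fun h => hg0 (AddMonoid.addOrderOf_eq_one_iff.mp h)
  have hpos : 0 < addOrderOf g :=
    addOrderOf_pos_iff.mpr (isOfFinAddOrder_iff_nsmul_eq_zero.mpr ⟨n, hn, hng⟩)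
  obtain ⟨p, hp, m, hm⟩ := Nat.exists_prime_and_dvd hord
  have hpm : p • m • g = 0 := by rw [← mul_nsmul', ← hm, addOrderOf_nsmul_eq_zero]
  have hmg : m • g = 0 := by
    refine hψ ⟨p, hp⟩ _ hpm fun i => ?_
    have h1 : ξ (⟨p, hp⟩, i) (m • g) = 0 := by rw [map_nsmul, hξ, nsmul_zero]
    have h2 : (p : ℤ) • θ (⟨p, hp⟩, i) (m • g) = 0 := by
      rw [natCast_zsmul, ← map_nsmul, hpm, map_zero]
    have h3 : ξ (⟨p, hp⟩, i) (m • g) =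
      ψ ⟨p, hp⟩ i (m • g) + (p : ℤ) • θ (⟨p, hp⟩, i) (m • g) := rfl
    rwa [h1, h2, add_zero, eq_comm] at h3
  have h4 := addOrderOf_dvd_iff_nsmul_eq_zero.mpr hmg
  have hm0 : 0 < m := Nat.pos_of_ne_zero fun h => by rw [h, mul_zero] at hm; omega
  have h5 := Nat.le_of_dvd hm0 h4
  rw [hm] at h5
  nlinarith [hp.two_le]

/-! ### The equivalence. -/

theorem mainTheorem4 (G : Type u) [AddCommGroup G] (I : Type v)
    (hI : Cardinal.mk I = Cardinal.continuum.{v}) :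
    (∃ H : AddSubgroup (I → UnitAddCircle),
        Dense (H : Set (I → UnitAddCircle)) ∧ Nonempty (G ≃+ H)) ↔
      (¬ ∃ n : ℕ, 0 < n ∧ ∀ x : G, n • x = 0) ∧
        Cardinal.mk G ≤ 2 ^ Cardinal.continuum.{u} := by
  constructor
  · rintro ⟨H, hH, ⟨e⟩⟩
    constructor
    · rintro ⟨n, hn, hnG⟩
      have : Nonempty I := mk_ne_zero_iff.mp (hI ▸ continuum_ne_zero)
      have hclosed : IsClosed {x : I → UnitAddCircle | n • x = 0} :=
        isClosed_eq (by fun_prop) continuous_const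
      have hall : ∀ x : I → UnitAddCircle, n • x = 0 := by
        intro x
        refine closure_minimal ?_ hclosed (hH x)
        intro y hy
        have h1 := hnG (e.symm ⟨y, hy⟩)
        rw [← map_nsmul, map_eq_zero_iff _ e.symm.injective] at h1
        exact congrArg Subtype.val h1
      -- The constant point `1 / (n + 1)` has order `n + 1`, so `n` cannot kill it.
      have h2 : n • ((1 / ((n + 1 : ℕ) : ℝ) : ℝ) : UnitAddCircle) = 0 :=
        congrFun (hall fun _ => _) (Classical.arbitrary I)
      have h3 : addOrderOf ((1 / ((n + 1 : ℕ) : ℝ) : ℝ) : UnitAddCircle) = n + 1 :=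
        AddCircle.addOrderOf_period_div n.succ_pos
      have h4 := addOrderOf_dvd_iff_nsmul_eq_zero.mpr h2
      rw [h3] at h4
      exact absurd (Nat.le_of_dvd hn h4) (by omega)
    · have h1 : #UnitAddCircle ≤ 𝔠 :=
        mk_real ▸ mk_le_of_surjective (QuotientAddGroup.mk'_surjective _)
      have h2 : #(I → UnitAddCircle) ≤ 2 ^ 𝔠 := by
        simp only [mk_pi, prod_const, hI, lift_uzero]
        calc _ ≤ (lift.{v} 𝔠) ^ 𝔠 := power_le_power_right (lift_le.mpr h1)
          _ = 2 ^ 𝔠 := by rw [lift_continuum, power_self_eq aleph0_le_continuum]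
      have h3 : lift.{v} #G ≤ lift.{u} #(I → UnitAddCircle) :=
        lift_mk_le_lift_mk_of_injective (f := fun g => (e g : I → UnitAddCircle))
          (Subtype.val_injective.comp e.injective)
      have h4 := h3.trans (lift_le.mpr h2)
      have h5 : lift.{u} ((2 : Cardinal.{v}) ^ (𝔠 : Cardinal.{v})) =
        lift.{v} ((2 : Cardinal.{u}) ^ (𝔠 : Cardinal.{u})) := by simp
      rw [h5] at h4
      exact lift_le.mp h4
  · rintro ⟨hG, hcard⟩
    obtain ⟨χ, hχ, hsep⟩ := exists_separating_linearIndependent hG hcard hI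
    let φ : G →+ (I → UnitAddCircle) :=
      AddMonoidHom.mk' (fun g i => χ i g) (fun a b => by ext; simp)
    have hφ : Function.Injective φ := by
      rw [injective_iff_map_eq_zero]
      exact fun g hg => hsep g fun i => congrFun hg i
    exact ⟨φ.range, hχ.denseRange_unitAddCircle, ⟨AddMonoidHom.ofInjective hφ⟩⟩
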